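/- Let $(\Omega,\mathscr F,\mathbb P)$ be a probability space with a filtration $\mathbb F=(\mathscr F_t)_{t\ge 0}$ satisfying the usual conditions. For a càdlàg process $Z$ let $Z_-$ be its left-limit process, with $Z_{0-}=Z_0$; write $\int_0^{\cdot}H\,dZ$ for the Itô integral and $[Z,Y]=ZY-Z_0Y_0-\int_0^\cdot Z_-\,dY-\int_0^\cdot Y_-\,dZ$ for the quadratic covariation. For processes $Z^n$, write $\mathrm{F}\text{-}\lim_n Z^n=L$ if, $\mathbb P$-almost surely, $\lim_{n\to\infty}Z^n_s$ exists for every $s\in\mathbb Q_+$ and $L_t=\lim_{s\downarrow t,\,s\in\mathbb Q_+}\lim_{n\to\infty}Z^n_s$ for all $t\ge 0$. Let $$Y=\mathbf 1_{[1,\infty)},\qquad X^n=\mathbf 1_{[1-\frac1{n+1},\infty)}\qquad(n\ge 1)$$ (deterministic processes). Then $Y$ and all $X^n$ are semimartingales, $X^n_0=0$ for every $n$, and the following hold. 1. $\sup_n\int_\Omega \mathrm{var}(X^n)_\infty\,d\mathbb P\le 1$, where $\mathrm{var}(X^n)_\infty$ is the total variation of the path on $[0,\infty)$. 2. For every sequence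 $\widetilde X^n\in\mathrm{co}\{X^m:m\ge n\}$ of forward convex combinations, $\mathrm{F}\text{-}\lim_n\widetilde X^n=Y$. 3. For every sequence $\widetilde X^n\in\mathrm{co}\{X^m:m\ge n\}$: - $\mathrm{F}\text{-}\lim_n\int_0^\cdot Y_-\,d\widetilde X^n=\int_0^\cdot Y_-\,dY$, and likewise $\mathrm{F}\text{-}\lim_n\int_0^\cdot Y_-\,d\widetilde X^n_-=\int_0^\cdot Y_-\,dY$, where for each $t$ the integral $\int_0^tY_-\,d\widetilde X^n_-$ is the pathwise integral of $Y_-$ against the Lebesgue–Stieltjes measure of the path $u\mapsto\widetilde X^n_{(u\wedge t)-}$; - $\mathrm{F}\text{-}\lim_n[\widetilde X^n,Y]$ exists but is not indistinguishable from $[Y,Y]$; - $\mathrm{F}\text{-}\lim_n\int_0^\cdot\widetilde X^n_-\,dY$ exists but is not indistinguishable from $\int_0^\cdot Y_-\,dY$. -/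

import Mathlib

open MeasureTheory ProbabilityTheory Filter Topology
open scoped NNReal ENNReal

namespace FatouCounterexample

noncomputable section

variable {Ω : Type*} {mΩ : MeasurableSpace Ω}

/-- The usual conditions: the filtration is right-continuous and its initial `σ`-algebra contains
all null sets (in particular the probability space is complete). -/
structure UsualConditions (𝔽 : Filtration ℝ≥0 mΩ) (P : Measure Ω) : Prop where
  rightContinuous : 𝔽.IsRightContinuous
  null : ∀ s : Set Ω, P s = 0 → MeasurableSet[𝔽 0] s

/-- A path is càdlàg: right-continuous with finite left limits. -/
def IsCadlag (f : ℝ≥0 → ℝ) : Prop :=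
  ∀ t, ContinuousWithinAt f (Set.Ici t) t ∧ ∃ l, Tendsto f (𝓝[<] t) (𝓝 l)

/-- Equality of processes up to an evanescent set. -/
def Indistinguishable (P : Measure Ω) (X Y : ℝ≥0 → Ω → ℝ) : Prop :=
  ∀ᵐ ω ∂P, ∀ t, X t ω = Y t ω

/-- The left limit process `X₋`; `Function.leftLim f 0 = f 0`, so that `X₋ 0 = X 0`. -/
def leftProc (X : ℝ≥0 → Ω → ℝ) : ℝ≥0 → Ω → ℝ :=
  fun t ω => Function.leftLim (fun s => X s ω) t

/-- Local martingales with càdlàg paths. -/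
def IsLocalMartingale (𝔽 : Filtration ℝ≥0 mΩ) (P : Measure Ω) (M : ℝ≥0 → Ω → ℝ) : Prop :=
  Locally (fun N : ℝ≥0 → Ω → ℝ => Martingale N 𝔽 P ∧ ∀ ω, IsCadlag (fun t => N t ω)) 𝔽 M P

/-- Semimartingales: adapted càdlàg processes of the form `X₀ + M + A`, with `M` a local martingale
and `A` an adapted càdlàg process with paths of locally finite variation, both null at zero. -/
structure IsSemimartingale (𝔽 : Filtration ℝ≥0 mΩ) (P : Measure Ω) (X : ℝ≥0 → Ω → ℝ) :
    Prop where
  adapted : Adapted 𝔽 X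
  cadlag : ∀ ω, IsCadlag (fun t => X t ω)
  decomposition : ∃ M A : ℝ≥0 → Ω → ℝ,
    IsLocalMartingale 𝔽 P M ∧ (∀ ω, M 0 ω = 0) ∧
    Adapted 𝔽 A ∧ (∀ ω, IsCadlag (fun t => A t ω)) ∧
    (∀ ω, LocallyBoundedVariationOn (fun t => A t ω) Set.univ) ∧ (∀ ω, A 0 ω = 0) ∧
    Indistinguishable P X (fun t ω => X 0 ω + M t ω + A t ω)

/-- Simple predictable processes
`ξ₀ 𝟙_{0} + ∑ i, ξ i 𝟙_{(T i, T (i+1)]}`, where `T 0 ≤ ⋯ ≤ T n` are finite stopping times, `ξ₀` is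
`𝔽 0`-measurable and `ξ i` is measurable with respect to the `σ`-algebra of `T i`. -/
structure SimplePredictable (𝔽 : Filtration ℝ≥0 mΩ) where
  n : ℕ
  T : Fin (n + 1) → Ω → ℝ≥0
  mono : ∀ ω, Monotone (fun i => T i ω)
  stopping : ∀ i, IsStoppingTime 𝔽 (fun ω => (T i ω : WithTop ℝ≥0))
  ξ₀ : Ω → ℝ
  measurable_ξ₀ : Measurable[𝔽 0] ξ₀
  ξ : Fin n → Ω → ℝ
  measurable_ξ : ∀ i, Measurable[(stopping i.castSucc).measurableSpace] (ξ i)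

namespace SimplePredictable

variable {𝔽 : Filtration ℝ≥0 mΩ}

/-- The value of a simple predictable process. -/
def val (S : SimplePredictable 𝔽) (t : ℝ≥0) (ω : Ω) : ℝ :=
  Set.indicator {0} (fun _ => S.ξ₀ ω) t +
    ∑ i : Fin S.n,
      Set.indicator (Set.Ioc (S.T i.castSucc ω) (S.T i.succ ω)) (fun _ => S.ξ i ω) t

/-- The elementary stochastic integral `∫_{(0,t]} S dZ` of a simple predictable process. -/
def integral (S : SimplePredictable 𝔽) (Z : ℝ≥0 → Ω → ℝ) (t : ℝ≥0) (ω : Ω) : ℝ :=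
  ∑ i : Fin S.n,
    S.ξ i ω * (Z (min (S.T i.succ ω) t) ω - Z (min (S.T i.castSucc ω) t) ω)

end SimplePredictable

/-- Uniform convergence on compacts in probability. -/
def TendstoUCP (P : Measure Ω) (X : ℕ → ℝ≥0 → Ω → ℝ) (L : ℝ≥0 → Ω → ℝ) : Prop :=
  ∀ t : ℝ≥0, ∀ ε : ℝ, 0 < ε →
    Tendsto (fun n => P {ω | ∃ s ≤ t, ε ≤ |X n s ω - L s ω|}) atTop (𝓝 0)

/-- `I` is (a version of) the Itô integral `∫₀^· H dZ` of the adapted left-continuous process `H`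
with respect to the semimartingale `Z`: the stochastic integral on such integrands is the unique
extension of the elementary integral that is continuous for ucp convergence. -/
structure IsItoIntegral (𝔽 : Filtration ℝ≥0 mΩ) (P : Measure Ω) (H Z I : ℝ≥0 → Ω → ℝ) :
    Prop where
  semimartingale : IsSemimartingale 𝔽 P Z
  adapted : Adapted 𝔽 I
  cadlag : ∀ ω, IsCadlag (fun t => I t ω)
  approximable : ∃ S : ℕ → SimplePredictable 𝔽, TendstoUCP P (fun k => (S k).val) H
  tendsto : ∀ S : ℕ → SimplePredictable 𝔽, TendstoUCP P (fun k => (S k).val) H →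
    TendstoUCP P (fun k => (S k).integral Z) I

/-- `C` is (a version of) the quadratic covariation
`[X, Y] = X Y - X₀ Y₀ - ∫ X₋ dY - ∫ Y₋ dX`. -/
def IsQuadCovariation (𝔽 : Filtration ℝ≥0 mΩ) (P : Measure Ω) (X Y C : ℝ≥0 → Ω → ℝ) : Prop :=
  ∃ I J : ℝ≥0 → Ω → ℝ,
    IsItoIntegral 𝔽 P (leftProc X) Y I ∧ IsItoIntegral 𝔽 P (leftProc Y) X J ∧
    Indistinguishable P C (fun t ω => X t ω * Y t ω - X 0 ω * Y 0 ω - I t ω - J t ω)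

/-- `I` is the pathwise Lebesgue–Stieltjes integral `∫₀^· H dV`, for an integrator `V` whose paths
have locally finite variation but need not be one-sided continuous: `I t` is the integral of `H`
against the Stieltjes measure of the path of `V` stopped at `t`. -/
def IsStieltjesIntegral (P : Measure Ω) (H V I : ℝ≥0 → Ω → ℝ) : Prop :=
  ∀ᵐ ω ∂P, ∀ t : ℝ≥0,
    ∃ hV : BoundedVariationOn (fun u : ℝ≥0 => V (min u t) ω) Set.univ,
      hV.vectorMeasure.Integrable (fun u => H u ω) ∧
      I t ω = ∫ᵛ u, H u ω ∂•hV.vectorMeasure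

/-- `L` is the process `lim_{s ↓ ·, s ∈ ℚ₊} lim_{n → ∞} X n s`: almost surely, all the limits exist
and `L` is given by them. -/
def IsFatouLimit (P : Measure Ω) (X : ℕ → ℝ≥0 → Ω → ℝ) (L : ℝ≥0 → Ω → ℝ) : Prop :=
  ∀ᵐ ω ∂P, ∃ ℓ : ℚ≥0 → ℝ,
    (∀ q : ℚ≥0, Tendsto (fun n => X n (q : ℝ≥0) ω) atTop (𝓝 (ℓ q))) ∧
    ∀ t : ℝ≥0, Tendsto ℓ (comap (fun q : ℚ≥0 => (q : ℝ≥0)) (𝓝[>] t)) (𝓝 (L t ω))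

end

end FatouCounterexample

namespace FatouCounterexample

open Finset Function

noncomputable section

variable {Ω : Type*} {mΩ : MeasurableSpace Ω}

/-! A forward convex combination from index `n` on is a deterministic path with finitely many jumps,
all at times `jumpTime m < 1` with `m ≥ n`, and of total size 1. It equals 1 on [1, ∞) and, at a
fixed t < 1, it is 0 once `jumpTime n > t`; hence the Fatou limit is Y.

What matters is that these jumps come strictly before time 1. Since Y₋ is the indicator of (1, ∞),
it vanishes at all of them and at 1, so its integrals against the combinations and against Y are all
0. The left limits of a combination, however, are already 1 at time 1, so their integral against Y
is Y, whereas ∫ Y₋ dY = 0. The covariation with Y is therefore 0, while [Y, Y] = Y.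

These computations rest on `isItoIntegral_jumpPath`, which turns an Itô integral against a jump path
into a sum over jumps, and on `variation_vectorMeasure_Ioi_eq_zero` for the Stieltjes integral. -/

/-- The right-continuous pure jump path with a jump of size `w m` at time `a m` for `m < N`. -/
def jumpPath (a : ℕ → ℝ≥0) (w : ℕ → ℝ) (N : ℕ) (t : ℝ≥0) : ℝ :=
  ∑ m ∈ range N, w m * if a m ≤ t then 1 else 0

/-- The left-continuous pure jump path with a jump of size `w m` at time `a m` for `m < N`. -/
def jumpPathLeft (a : ℕ → ℝ≥0) (w : ℕ → ℝ) (N : ℕ) (t : ℝ≥0) : ℝ :=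
  ∑ m ∈ range N, w m * if a m < t then 1 else 0

/-! ### Regularity and left limits of jump paths. -/

section Paths

variable (a : ℕ → ℝ≥0) (w : ℕ → ℝ) (N : ℕ)

lemma tendsto_jumpPath_right (t : ℝ≥0) :
    Tendsto (jumpPath a w N) (𝓝[≥] t) (𝓝 (jumpPath a w N t)) := by
  refine tendsto_finsetSum _ fun m _ => ?_
  refine tendsto_const_nhds.mul (tendsto_const_nhds.congr' ?_)
  by_cases h : a m ≤ t
  · filter_upwards [self_mem_nhdsWithin] with s hs
    simp [h, h.trans hs]
  · filter_upwards [mem_nhdsWithin_of_mem_nhds (Iio_mem_nhds (not_le.1 h))] with s hs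
    simp [h, not_le.2 (Set.mem_Iio.1 hs)]

lemma tendsto_jumpPath_left (t : ℝ≥0) :
    Tendsto (jumpPath a w N) (𝓝[<] t) (𝓝 (jumpPathLeft a w N t)) := by
  refine tendsto_finsetSum _ fun m _ => ?_
  refine tendsto_const_nhds.mul (tendsto_const_nhds.congr' ?_)
  by_cases h : a m < t
  · filter_upwards [mem_nhdsWithin_of_mem_nhds (Ioi_mem_nhds h)] with s hs
    simp [h, (Set.mem_Ioi.1 hs).le]
  · filter_upwards [self_mem_nhdsWithin] with s hs
    simp [h, (Set.mem_Iio.1 hs).trans_le (not_lt.1 h)]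

lemma isCadlag_jumpPath : IsCadlag (jumpPath a w N) := fun t =>
  ⟨tendsto_jumpPath_right a w N t, _, tendsto_jumpPath_left a w N t⟩

variable {a w N}

lemma jumpPath_zero (ha : ∀ m, 0 < a m) : jumpPath a w N 0 = 0 := by
  simp [jumpPath, (ha _).ne']

lemma leftLim_jumpPath (ha : ∀ m, 0 < a m) (t : ℝ≥0) :
    leftLim (jumpPath a w N) t = jumpPathLeft a w N t := by
  rcases eq_or_ne t 0 with rfl | ht
  · rw [leftLim_eq_of_isBot (fun _ => zero_le), jumpPath_zero ha]
    simp [jumpPathLeft]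
  · have : (𝓝[<] t).NeBot := nhdsLT_neBot_of_exists_lt ⟨0, pos_iff_ne_zero.2 ht⟩
    exact leftLim_eq_of_tendsto (tendsto_jumpPath_left a w N t)

lemma monotone_jumpPath (hw : ∀ m, 0 ≤ w m) : Monotone (jumpPath a w N) := fun s t hst => by
  refine sum_le_sum fun m _ => mul_le_mul_of_nonneg_left ?_ (hw m)
  split_ifs with h₁ h₂ <;> first | exact absurd (h₁.trans hst) h₂ | norm_num

lemma monotone_jumpPathLeft (hw : ∀ m, 0 ≤ w m) : Monotone (jumpPathLeft a w N) := fun s t hst => by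
  refine sum_le_sum fun m _ => mul_le_mul_of_nonneg_left ?_ (hw m)
  split_ifs with h₁ h₂ <;> first | exact absurd (h₁.trans_le hst) h₂ | norm_num

lemma jumpPathLeft_mem_Icc (hw : ∀ m, 0 ≤ w m) (t : ℝ≥0) :
    jumpPathLeft a w N t ∈ Set.Icc 0 (∑ m ∈ range N, w m) := by
  refine ⟨sum_nonneg fun m _ => mul_nonneg (hw m) (by split_ifs <;> norm_num),
    sum_le_sum fun m _ => mul_le_of_le_one_right (hw m) (by split_ifs <;> norm_num)⟩

end Paths

/-! ### Total variation and Stieltjes measures. -/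

lemma eVariationOn_le_of_monotone_of_mem_Icc {α : Type*} [LinearOrder α] {f : α → ℝ} {c d : ℝ}
    (hf : Monotone f) (h : ∀ t, f t ∈ Set.Icc c d) :
    eVariationOn f Set.univ ≤ ENNReal.ofReal (d - c) := by
  rcases isEmpty_or_nonempty α with hα | ⟨⟨t⟩⟩
  · simp [eVariationOn.subsingleton f (Set.subsingleton_of_subsingleton)]
  have hcd : c ≤ d := (h t).1.trans (h t).2
  calc eVariationOn (id ∘ f) Set.univ ≤ eVariationOn id (Set.Icc c d) :=
        eVariationOn.comp_le_of_monotoneOn _ _ (hf.monotoneOn _) fun t _ => h t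
    _ = eVariationOn id (Set.Icc c d ∩ Set.Icc c d) := by rw [Set.inter_self]
    _ = ENNReal.ofReal (d - c) :=
        (monotone_id.monotoneOn _).eVariationOn_eq (Set.left_mem_Icc.2 hcd)
          (Set.right_mem_Icc.2 hcd)

/-- The measure of a function of bounded variation does not charge the half-lines on which the
function is constant. -/
lemma variation_vectorMeasure_Ioi_eq_zero {f : ℝ≥0 → ℝ} (hf : BoundedVariationOn f Set.univ)
    {c : ℝ≥0} (hc : ∀ u, c ≤ u → f u = f c) : hf.vectorMeasure.variation (Set.Ioi c) = 0 := by
  have hright : ∀ u, c ≤ u → f.rightLim u = f c := fun u hu =>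
    rightLim_eq_of_tendsto <| tendsto_const_nhds.congr' <| by
      filter_upwards [self_mem_nhdsWithin] with v hv
      exact (hc v (hu.trans (Set.mem_Ioi.1 hv).le)).symm
  have hlim : limUnder atTop f = f c :=
    (tendsto_const_nhds.congr' <| by
      filter_upwards [eventually_ge_atTop c] with v hv using (hc v hv).symm).limUnder_eq
  -- Half-lines form a π-system generating the Borel sets, and the measure of one inside (c, ∞) is
  -- the limit at infinity minus a right limit, both equal to f c.
  have hzero : hf.vectorMeasure.restrict (Set.Ioi c) = 0 := by
    refine VectorMeasure.ext_of_generateFrom (Set.range Set.Ioi) ?_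
      (by rw [← borel_eq_generateFrom_Ioi]; exact BorelSpace.measurable_eq) isPiSystem_Ioi ?_
    rotate_left
    · rw [VectorMeasure.restrict_apply _ measurableSet_Ioi MeasurableSet.univ, Set.univ_inter,
        hf.vectorMeasure_Ioi, hlim, hright c le_rfl]
      simp
    · rintro _ ⟨u, rfl⟩
      rw [VectorMeasure.restrict_apply _ measurableSet_Ioi measurableSet_Ioi, Set.Ioi_inter_Ioi,
        hf.vectorMeasure_Ioi, hlim, hright _ le_sup_right]
      simp
  rw [VectorMeasure.variation_apply_eq_zero measurableSet_Ioi]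
  intro t ht htm
  have := congrArg (fun ν => ν t) hzero
  simpa [VectorMeasure.restrict_apply _ measurableSet_Ioi htm, Set.inter_eq_left.2 ht] using this

/-! ### Itô integrals against jump paths. -/

section Processes

variable {P : Measure Ω} {𝔽 : Filtration ℝ≥0 mΩ}

lemma isLocalMartingale_zero : IsLocalMartingale 𝔽 P 0 := by
  refine Locally.of_prop ⟨martingale_zero _ _ _, fun ω t => ?_⟩
  exact ⟨continuousWithinAt_const, 0, tendsto_const_nhds⟩

variable {a : ℕ → ℝ≥0} {w : ℕ → ℝ} {N : ℕ}

lemma isSemimartingale_jumpPath (ha : ∀ m, 0 < a m) (hw : ∀ m, 0 ≤ w m) :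
    IsSemimartingale 𝔽 P fun t _ => jumpPath a w N t where
  adapted _ := measurable_const
  cadlag _ := isCadlag_jumpPath a w N
  decomposition := by
    refine ⟨0, fun t _ => jumpPath a w N t, isLocalMartingale_zero, fun _ => rfl,
      fun _ => measurable_const, fun _ => isCadlag_jumpPath a w N,
      fun _ => ((monotone_jumpPath hw).monotoneOn _).locallyBoundedVariationOn,
      fun _ => jumpPath_zero ha, ae_of_all _ fun ω t => ?_⟩
    simp [jumpPath_zero ha]

/-- The increment over (T i, T (i+1)] collects the jumps in that interval; exchanging the two sums
groups the coefficients by jump. The value at 0 plays no role because jump times are positive. -/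
lemma SimplePredictable.integral_jumpPath (S : SimplePredictable 𝔽) (ha : ∀ m, 0 < a m)
    (t : ℝ≥0) (ω : Ω) :
    S.integral (fun t _ => jumpPath a w N t) t ω = jumpPath a (fun m => w m * S.val (a m) ω) N t := by
  simp only [SimplePredictable.integral, jumpPath, ← sum_sub_distrib, mul_sum]
  rw [sum_comm]
  refine sum_congr rfl fun m _ => ?_
  have h₀ : Set.indicator {0} (fun _ => S.ξ₀ ω) (a m) = 0 :=
    Set.indicator_of_notMem (by simpa using (ha m).ne') _
  simp only [SimplePredictable.val, h₀, zero_add, mul_sum, sum_mul]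
  refine sum_congr rfl fun i _ => ?_
  have hi : S.T i.castSucc ω ≤ S.T i.succ ω := S.mono ω (Fin.castSucc_lt_succ).le
  simp only [Set.indicator, Set.mem_Ioc, le_min_iff]
  split_ifs <;> grind

/-- The Itô integral of a deterministic process against a pure jump path. -/
lemma isItoIntegral_jumpPath {h : ℝ≥0 → ℝ} (ha : ∀ m, 0 < a m) (hw : ∀ m, 0 ≤ w m)
    (hw₁ : ∑ m ∈ range N, w m ≤ 1)
    (happ : ∃ S : ℕ → SimplePredictable 𝔽, TendstoUCP P (fun k => (S k).val) fun t _ => h t) :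
    IsItoIntegral 𝔽 P (fun t _ => h t) (fun t _ => jumpPath a w N t)
      (fun t _ => jumpPath a (fun m => w m * h (a m)) N t) where
  semimartingale := isSemimartingale_jumpPath ha hw
  adapted _ := measurable_const
  cadlag _ := isCadlag_jumpPath _ _ _
  approximable := happ
  tendsto S hS t ε hε := by
    -- The sum of the jump times is a horizon beyond every single jump. With weights summing to at
    -- most 1, an integrand error below ε/2 there keeps the integral error below ε at all times.
    refine tendsto_of_tendsto_of_tendsto_of_le_of_le tendsto_const_nhds
      (hS (∑ m ∈ range N, a m) (ε / 2) (half_pos hε)) (fun _ => zero_le) fun k => ?_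
    refine measure_mono ?_
    rintro ω ⟨s, -, hs⟩
    by_contra hcon
    have hlt : ∀ r ≤ ∑ m ∈ range N, a m, |(S k).val r ω - h r| < ε / 2 := by
      simpa using hcon
    simp only [SimplePredictable.integral_jumpPath _ ha] at hs
    have hle : |jumpPath a (fun m => w m * (S k).val (a m) ω) N s -
        jumpPath a (fun m => w m * h (a m)) N s| ≤ ∑ m ∈ range N, w m * (ε / 2) := by
      rw [jumpPath, jumpPath, ← sum_sub_distrib]
      refine (abs_sum_le_sum_abs _ _).trans (sum_le_sum fun m hm => ?_)
      rw [← sub_mul, ← mul_sub, mul_assoc, abs_mul, abs_of_nonneg (hw m)]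
      refine mul_le_mul_of_nonneg_left ?_ (hw m)
      have := (hlt (a m) (single_le_sum (fun _ _ => zero_le) hm)).le
      split_ifs
      · simpa using this
      · simpa using (half_pos hε).le
    rw [← sum_mul] at hle
    nlinarith

/-- Summation by parts: on each interval the step function is the partial sum of the jumps made so
far. -/
lemma sum_indicator_Ioc_eq {b : ℕ → ℝ≥0} (hb : Monotone b) (w : ℕ → ℝ) (N : ℕ) (t : ℝ≥0) :
    ∑ i ∈ range N, Set.indicator (Set.Ioc (b i) (b (i + 1)))
      (fun _ => ∑ m ∈ range (i + 1), w m) t =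
    ∑ m ∈ range N, Set.indicator (Set.Ioc (b m) (b N)) (fun _ => w m) t := by
  induction N with
  | zero => simp
  | succ N ih =>
    rw [sum_range_succ, ih, sum_range_succ, sum_range_succ, Set.indicator_add (s := Set.Ioc _ _)
      (f := fun _ => ∑ m ∈ range N, w m) (g := fun _ => w N), ← add_assoc]
    congr 1
    by_cases h : t ∈ Set.Ioc (b N) (b (N + 1))
    · rw [Set.indicator_of_mem h, sum_eq_zero, zero_add]
      · refine sum_congr rfl fun m hm => ?_
        rw [Set.indicator_of_mem]
        exact ⟨(hb (mem_range.1 hm).le).trans_lt h.1, h.2⟩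
      · intro m _
        exact Set.indicator_of_notMem (fun h' => absurd h'.2 (not_le.2 h.1)) _
    · rw [Set.indicator_of_notMem h, add_zero]
      refine sum_congr rfl fun m _ => ?_
      have hN := hb N.le_succ
      simp only [Set.indicator, Set.mem_Ioc] at h ⊢
      congr 1
      apply propext
      constructor
      · exact fun h' => ⟨h'.1, h'.2.trans hN⟩
      · exact fun h' => ⟨h'.1, not_lt.1 fun h'' => h ⟨h'', h'.2⟩⟩

variable (𝔽) in
/-- The simple predictable process which agrees with `jumpPathLeft a w N` on `[0, k]` when `a` is
monotone. -/
def simplePredictableOfJumps (ha : Monotone a) (w : ℕ → ℝ) (N k : ℕ) : SimplePredictable 𝔽 where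
  n := N
  -- The last node closes the final interval; `a N + k` exceeds both k and all earlier nodes.
  T i _ := if (i : ℕ) < N then a i else a N + k
  mono _ i j hij := by
    dsimp only
    split_ifs with h₁ h₂ h₂
    · exact ha hij
    · exact (ha h₁.le).trans le_self_add
    · exact absurd ((Fin.le_def.1 hij).trans_lt h₂) h₁
    · exact le_rfl
  stopping i := isStoppingTime_const 𝔽 _
  ξ₀ _ := 0
  measurable_ξ₀ := measurable_const
  ξ i _ := ∑ m ∈ range (i + 1), w m
  measurable_ξ _ := measurable_const

lemma simplePredictableOfJumps_val (ha : Monotone a) {k : ℕ} {t : ℝ≥0} (ht : t ≤ k) (ω : Ω) :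
    (simplePredictableOfJumps 𝔽 ha w N k).val t ω = jumpPathLeft a w N t := by
  set b : ℕ → ℝ≥0 := fun i => if i < N then a i else a N + k with hb
  have hmono : Monotone b := fun i j hij => by
    simp only [hb]
    split_ifs with h₁ h₂ h₂
    · exact ha hij
    · exact (ha h₁.le).trans le_self_add
    · omega
    · exact le_rfl
  have hval : (simplePredictableOfJumps 𝔽 ha w N k).val t ω = ∑ i ∈ range N,
      Set.indicator (Set.Ioc (b i) (b (i + 1))) (fun _ => ∑ m ∈ range (i + 1), w m) t := by
    rw [← Fin.sum_univ_eq_sum_range (fun i => Set.indicator (Set.Ioc (b i) (b (i + 1)))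
      (fun _ => ∑ m ∈ range (i + 1), w m) t)]
    simp [SimplePredictable.val, simplePredictableOfJumps, hb]
    rfl
  rw [hval, sum_indicator_Ioc_eq hmono, jumpPathLeft]
  refine sum_congr rfl fun m hm => ?_
  have : t ≤ a N + k := ht.trans le_add_self
  simp [hb, mem_range.1 hm, Set.indicator, this]

/-- On [0, t] the approximants are exact as soon as k ≥ t, so the exceptional sets are eventually
empty. -/
lemma exists_tendstoUCP_jumpPathLeft (ha : Monotone a) (w : ℕ → ℝ) (N : ℕ) :
    ∃ S : ℕ → SimplePredictable 𝔽,
      TendstoUCP P (fun k => (S k).val) fun t _ => jumpPathLeft a w N t := by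
  refine ⟨simplePredictableOfJumps 𝔽 ha w N, fun t ε hε => tendsto_const_nhds.congr' ?_⟩
  obtain ⟨K, hK⟩ := exists_nat_ge t
  filter_upwards [eventually_ge_atTop K] with k hk
  symm
  convert! measure_empty (μ := P)
  refine Set.eq_empty_of_forall_notMem ?_
  rintro ω ⟨s, hs, h⟩
  rw [simplePredictableOfJumps_val ha ((hs.trans hK).trans (by exact_mod_cast hk)), sub_self,
    abs_zero] at h
  exact absurd h (not_le.2 hε)

lemma isFatouLimit_of_eventually_eq {X : ℕ → ℝ≥0 → Ω → ℝ} {f : ℝ≥0 → ℝ}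
    (hf : ∀ t, ContinuousWithinAt f (Set.Ici t) t)
    (h : ∀ t, ∀ᶠ n in atTop, ∀ ω, X n t ω = f t) : IsFatouLimit P X fun t _ => f t := by
  refine ae_of_all _ fun ω => ⟨fun q => f q, fun q => tendsto_const_nhds.congr' ?_, fun t => ?_⟩
  · filter_upwards [h q] with n hn using (hn ω).symm
  · exact ((hf t).tendsto.mono_left (nhdsWithin_mono _ Set.Ioi_subset_Ici_self)).comp tendsto_comap

end Processes

end

end FatouCounterexample
-- Convex combinations, jump times and the limit path.
namespace FatouCounterexample

open Finset Function

noncomputable section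

variable {Ω : Type*} {mΩ : MeasurableSpace Ω} {P : Measure Ω} {𝔽 : Filtration ℝ≥0 mΩ}

lemma leftProc_jumpPath {a : ℕ → ℝ≥0} (ha : ∀ m, 0 < a m) (w : ℕ → ℝ) (N : ℕ) :
    leftProc (fun t (_ : Ω) => jumpPath a w N t) = fun t _ => jumpPathLeft a w N t :=
  funext fun t => funext fun _ => leftLim_jumpPath ha t

/-- Forward convex combinations of the indicators of `[a m, ∞)` are pure jump paths. -/
lemma exists_eq_jumpPath_of_mem_convexHull {a : ℕ → ℝ≥0} {n : ℕ} {Z : ℝ≥0 → Ω → ℝ}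
    (hZ : Z ∈ convexHull ℝ
      ((fun m (t : ℝ≥0) (_ : Ω) => if a m ≤ t then (1 : ℝ) else 0) '' Set.Ici n)) :
    ∃ (w : ℕ → ℝ) (N : ℕ), (∀ m, 0 ≤ w m) ∧ (∀ m < n, w m = 0) ∧ ∑ m ∈ range N, w m = 1 ∧
      Z = fun t _ => jumpPath a w N t := by
  classical
  obtain ⟨ι, _, v, z, hv, hv₁, hz, rfl⟩ := mem_convexHull_iff_exists_fintype.1 hZ
  choose k hk hkz using hz
  -- The indices `k i` may repeat, so weights are added up over each fibre of `k`.
  have hmaps : ∀ i ∈ (univ : Finset ι), k i ∈ range (univ.sup k + 1) := fun i _ =>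
    mem_range.2 (Nat.lt_succ_of_le (le_sup (mem_univ i)))
  refine ⟨fun m => ∑ i with k i = m, v i, univ.sup k + 1, fun m => sum_nonneg fun i _ => hv i,
    fun m hm => sum_eq_zero fun i hi => ?_, ?_, ?_⟩
  · exact absurd (hk i) (by simpa [(mem_filter.1 hi).2] using hm)
  · rw [sum_fiberwise_of_maps_to hmaps, hv₁]
  · funext t ω
    simp only [jumpPath, sum_mul]
    rw [Finset.sum_apply, Finset.sum_apply, ← sum_fiberwise_of_maps_to hmaps]
    refine sum_congr rfl fun m _ => sum_congr rfl fun i hi => ?_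
    rw [← hkz i, (mem_filter.1 hi).2]
    rfl

/-- The jump time `1 - 1 / (m + 2)`. -/
def jumpTime (m : ℕ) : ℝ≥0 := (m + 1) / (m + 2)

lemma coe_jumpTime (m : ℕ) : (jumpTime m : ℝ) = 1 - 1 / ((m : ℝ) + 2) := by
  have : (m : ℝ) + 2 ≠ 0 := by positivity
  simp only [jumpTime, NNReal.coe_div, NNReal.coe_add, NNReal.coe_natCast, NNReal.coe_one,
    NNReal.coe_ofNat]
  field_simp
  ring

lemma jumpTime_pos (m : ℕ) : 0 < jumpTime m := by
  unfold jumpTime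
  positivity

lemma jumpTime_lt_one (m : ℕ) : jumpTime m < 1 := by
  rw [← NNReal.coe_lt_coe, coe_jumpTime, NNReal.coe_one]
  have : 0 < 1 / ((m : ℝ) + 2) := by positivity
  linarith

lemma monotone_jumpTime : Monotone jumpTime := fun m n h => by
  rw [← NNReal.coe_le_coe, coe_jumpTime, coe_jumpTime]
  have : (m : ℝ) ≤ n := by exact_mod_cast h
  gcongr

lemma eventually_lt_jumpTime {t : ℝ≥0} (ht : t < 1) : ∀ᶠ n in atTop, t < jumpTime n := by
  have h : 0 < 1 - (t : ℝ) := sub_pos.2 (by exact_mod_cast ht)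
  obtain ⟨K, hK⟩ := exists_nat_one_div_lt h
  filter_upwards [eventually_ge_atTop K] with n hn
  refine lt_of_lt_of_le ?_ (monotone_jumpTime hn)
  rw [← NNReal.coe_lt_coe, coe_jumpTime]
  have : 1 / ((K : ℝ) + 2) ≤ 1 / ((K : ℝ) + 1) := by gcongr; norm_num
  linarith

/-- The path `𝟙_[1,∞)`. -/
def unitJump : ℝ≥0 → ℝ := jumpPath (fun _ => 1) (fun _ => 1) 1

lemma unitJump_apply (t : ℝ≥0) : unitJump t = if 1 ≤ t then 1 else 0 := by
  simp [unitJump, jumpPath]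

lemma leftProc_unitJump :
    leftProc (fun t (_ : Ω) => unitJump t) = fun t _ => if 1 < t then (1 : ℝ) else 0 := by
  rw [unitJump, leftProc_jumpPath fun _ => one_pos]
  simp [jumpPathLeft]

lemma exists_tendstoUCP_leftProc_unitJump : ∃ S : ℕ → SimplePredictable 𝔽,
    TendstoUCP P (fun k => (S k).val) fun t _ => if 1 < t then (1 : ℝ) else 0 := by
  simpa [jumpPathLeft] using
    exists_tendstoUCP_jumpPathLeft (P := P) (𝔽 := 𝔽) (a := fun _ => 1) monotone_const
      (fun _ => 1) 1

lemma isItoIntegral_unitJump {h : ℝ≥0 → ℝ}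
    (happ : ∃ S : ℕ → SimplePredictable 𝔽, TendstoUCP P (fun k => (S k).val) fun t _ => h t) :
    IsItoIntegral 𝔽 P (fun t _ => h t) (fun t _ => unitJump t) fun t _ => h 1 * unitJump t := by
  have := isItoIntegral_jumpPath (a := fun _ => 1) (w := fun _ => 1) (N := 1)
    (fun _ => one_pos) (fun _ => zero_le_one) (by simp) happ
  simpa [unitJump, jumpPath] using this

lemma isItoIntegral_leftProc_unitJump_self :
    IsItoIntegral 𝔽 P (leftProc fun t _ => unitJump t) (fun t _ => unitJump t) 0 := by
  rw [leftProc_unitJump]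
  convert isItoIntegral_unitJump (P := P) (𝔽 := 𝔽) (h := fun t => if 1 < t then 1 else 0)
    exists_tendstoUCP_leftProc_unitJump using 1
  funext t ω
  simp

/-! ### Integrals and covariation of the combinations. -/

section Combination

variable {w : ℕ → ℝ} {N : ℕ}

lemma jumpPath_jumpTime_of_one_le (hw₁ : ∑ m ∈ range N, w m = 1) {t : ℝ≥0} (ht : 1 ≤ t) :
    jumpPath jumpTime w N t = 1 := by
  simp [jumpPath, ((jumpTime_lt_one _).trans_le ht).le, hw₁]

lemma jumpPathLeft_jumpTime_of_one_le (hw₁ : ∑ m ∈ range N, w m = 1) {t : ℝ≥0} (ht : 1 ≤ t) :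
    jumpPathLeft jumpTime w N t = 1 := by
  simp [jumpPathLeft, (jumpTime_lt_one _).trans_le ht, hw₁]

lemma jumpPath_jumpTime_of_lt {n : ℕ} (hwn : ∀ m < n, w m = 0) {t : ℝ≥0}
    (ht : t < jumpTime n) : jumpPath jumpTime w N t = 0 := by
  refine sum_eq_zero fun m _ => ?_
  rcases lt_or_ge m n with h | h
  · simp [hwn m h]
  · simp [ht.trans_le (monotone_jumpTime h)]

lemma isItoIntegral_leftProc_unitJump (hw : ∀ m, 0 ≤ w m) (hw₁ : ∑ m ∈ range N, w m = 1) :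
    IsItoIntegral 𝔽 P (leftProc fun t _ => unitJump t) (fun t _ => jumpPath jumpTime w N t) 0 := by
  rw [leftProc_unitJump]
  convert isItoIntegral_jumpPath (P := P) (𝔽 := 𝔽) (h := fun t => if 1 < t then 1 else 0)
    jumpTime_pos hw hw₁.le exists_tendstoUCP_leftProc_unitJump using 1
  funext t ω
  simp [jumpPath, (jumpTime_lt_one _).not_gt]

lemma isItoIntegral_leftProc_jumpPath (hw₁ : ∑ m ∈ range N, w m = 1) :
    IsItoIntegral 𝔽 P (leftProc fun t _ => jumpPath jumpTime w N t) (fun t _ => unitJump t)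
      fun t _ => unitJump t := by
  rw [leftProc_jumpPath jumpTime_pos]
  have := isItoIntegral_unitJump (exists_tendstoUCP_jumpPathLeft (P := P) (𝔽 := 𝔽)
    monotone_jumpTime w N)
  simpa [jumpPathLeft_jumpTime_of_one_le hw₁] using this

lemma isQuadCovariation_jumpPath_unitJump (hw : ∀ m, 0 ≤ w m) (hw₁ : ∑ m ∈ range N, w m = 1) :
    IsQuadCovariation 𝔽 P (fun t _ => jumpPath jumpTime w N t) (fun t _ => unitJump t) 0 := by
  refine ⟨_, _, isItoIntegral_leftProc_jumpPath hw₁, isItoIntegral_leftProc_unitJump hw hw₁,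
    ae_of_all _ fun ω t => ?_⟩
  -- From time 1 on the expression is 1 · 1 - 0 - 1 - 0; before it every term is 0.
  by_cases ht : 1 ≤ t
  · simp [unitJump_apply, ht, jumpPath_jumpTime_of_one_le hw₁]
  · simp [unitJump_apply, ht]

lemma isStieltjesIntegral_leftProc_unitJump (hw : ∀ m, 0 ≤ w m)
    (hw₁ : ∑ m ∈ range N, w m = 1) :
    IsStieltjesIntegral P (leftProc fun t _ => unitJump t)
      (leftProc fun t _ => jumpPath jumpTime w N t) 0 := by
  rw [leftProc_unitJump, leftProc_jumpPath jumpTime_pos]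
  refine ae_of_all _ fun ω t => ?_
  have hmono : Monotone fun u => jumpPathLeft jumpTime w N (min u t) := fun u v huv =>
    monotone_jumpPathLeft hw (min_le_min_right t huv)
  have hV : BoundedVariationOn (fun u => jumpPathLeft jumpTime w N (min u t)) Set.univ :=
    ((eVariationOn_le_of_monotone_of_mem_Icc hmono fun u =>
      jumpPathLeft_mem_Icc hw _).trans_lt ENNReal.ofReal_lt_top).ne
  -- The stopped path is constant on [1, ∞), so its measure misses (1, ∞), the set where Y₋ is
  -- nonzero.
  have hnull : hV.vectorMeasure.variation (Set.Ioi 1) = 0 := by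
    refine variation_vectorMeasure_Ioi_eq_zero hV fun u hu => ?_
    rcases le_total 1 t with ht | ht
    · rw [jumpPathLeft_jumpTime_of_one_le hw₁ (le_min hu ht),
        jumpPathLeft_jumpTime_of_one_le hw₁ (le_min le_rfl ht)]
    · rw [min_eq_right ht, min_eq_right (ht.trans hu)]
  have hae : (fun u : ℝ≥0 => if 1 < u then (1 : ℝ) else 0) =ᵐ[hV.vectorMeasure.variation] 0 := by
    filter_upwards [measure_eq_zero_iff_ae_notMem.1 hnull] with u hu
    simpa using hu
  exact ⟨hV, (integrable_zero _ _ _).congr hae.symm,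
    (VectorMeasure.integral_eq_zero_of_ae hae).symm⟩

end Combination

lemma isQuadCovariation_unitJump_self :
    IsQuadCovariation 𝔽 P (fun t _ => unitJump t) (fun t _ => unitJump t)
      fun t _ => unitJump t := by
  refine ⟨_, _, isItoIntegral_leftProc_unitJump_self, isItoIntegral_leftProc_unitJump_self,
    ae_of_all _ fun ω t => ?_⟩
  simp [unitJump_apply]

lemma isFatouLimit_zero : IsFatouLimit P (fun _ : ℕ => (0 : ℝ≥0 → Ω → ℝ)) 0 :=
  isFatouLimit_of_eventually_eq (f := fun _ => 0) (fun _ => continuousWithinAt_const)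
    fun _ => Eventually.of_forall fun _ _ => rfl

lemma continuousWithinAt_unitJump (t : ℝ≥0) : ContinuousWithinAt unitJump (Set.Ici t) t :=
  (isCadlag_jumpPath _ _ _ t).1

end

end FatouCounterexample

theorem theorem4 {Ω : Type*} {mΩ : MeasurableSpace Ω} (P : Measure Ω) [IsProbabilityMeasure P]
    (𝔽 : Filtration ℝ≥0 mΩ) (h𝔽 : FatouCounterexample.UsualConditions 𝔽 P) :
    ∃ (Y : ℝ≥0 → Ω → ℝ) (X : ℕ → ℝ≥0 → Ω → ℝ),
      -- the processes, with `X n` standing for the member of index `n + 1` of the sequence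
      (∀ t ω, Y t ω = if 1 ≤ t then 1 else 0) ∧
      (∀ n t ω, X n t ω = if 1 - 1 / ((n : ℝ) + 2) ≤ (t : ℝ) then 1 else 0) ∧
      FatouCounterexample.IsSemimartingale 𝔽 P Y ∧
      (∀ n, FatouCounterexample.IsSemimartingale 𝔽 P (X n)) ∧
      (∀ n ω, X n 0 ω = 0) ∧
      -- the expected total variations are bounded by one
      (⨆ n, ∫⁻ ω, eVariationOn (fun t => X n t ω) Set.univ ∂P) ≤ 1 ∧
      -- `J` is the integral of `Y₋` against `Y`, and `Q` is `[Y, Y]`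
      ∃ J Q : ℝ≥0 → Ω → ℝ,
        FatouCounterexample.IsItoIntegral 𝔽 P (FatouCounterexample.leftProc Y) Y J ∧
        FatouCounterexample.IsQuadCovariation 𝔽 P Y Y Q ∧
        ∀ Xt : ℕ → ℝ≥0 → Ω → ℝ, (∀ n, Xt n ∈ convexHull ℝ (X '' Set.Ici n)) →
          FatouCounterexample.IsFatouLimit P Xt Y ∧
          -- the integrals of `Y₋` against `Xt n`, and those against `(Xt n)₋`, converge to `J`
          (∃ I : ℕ → ℝ≥0 → Ω → ℝ,
            (∀ n, FatouCounterexample.IsItoIntegral 𝔽 P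
              (FatouCounterexample.leftProc Y) (Xt n) (I n)) ∧
            FatouCounterexample.IsFatouLimit P I J) ∧
          (∃ I : ℕ → ℝ≥0 → Ω → ℝ,
            (∀ n, FatouCounterexample.IsStieltjesIntegral P
              (FatouCounterexample.leftProc Y) (FatouCounterexample.leftProc (Xt n)) (I n)) ∧
            FatouCounterexample.IsFatouLimit P I J) ∧
          -- the limit of `[Xt n, Y]` exists and is not `[Y, Y]`
          (∃ (C : ℕ → ℝ≥0 → Ω → ℝ) (L : ℝ≥0 → Ω → ℝ),
            (∀ n, FatouCounterexample.IsQuadCovariation 𝔽 P (Xt n) Y (C n)) ∧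
            FatouCounterexample.IsFatouLimit P C L ∧
            ¬ FatouCounterexample.Indistinguishable P L Q) ∧
          -- the limit of the integrals of `(Xt n)₋` against `Y` exists and is not `J`
          (∃ (I : ℕ → ℝ≥0 → Ω → ℝ) (L : ℝ≥0 → Ω → ℝ),
            (∀ n, FatouCounterexample.IsItoIntegral 𝔽 P
              (FatouCounterexample.leftProc (Xt n)) Y (I n)) ∧
            FatouCounterexample.IsFatouLimit P I L ∧
            ¬ FatouCounterexample.Indistinguishable P L J) := by
  open FatouCounterexample in
  refine ⟨fun t _ => unitJump t, fun n t _ => if jumpTime n ≤ t then 1 else 0,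
    fun t _ => unitJump_apply t, fun n t _ => ?_,
    isSemimartingale_jumpPath (fun _ => one_pos) fun _ => zero_le_one, fun n => ?_,
    fun n ω => by simp [(jumpTime_pos n).ne'], iSup_le fun n => ?_, 0, fun t _ => unitJump t,
    isItoIntegral_leftProc_unitJump_self, isQuadCovariation_unitJump_self, fun Xt hXt => ?_⟩
  · simp only [← coe_jumpTime, NNReal.coe_le_coe]
  · simpa [jumpPath] using isSemimartingale_jumpPath (P := P) (𝔽 := 𝔽) (N := 1)
      (a := fun _ => jumpTime n) (w := fun _ => 1) (fun _ => jumpTime_pos n) fun _ => zero_le_one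
  · have hle : eVariationOn (fun t => if jumpTime n ≤ t then (1 : ℝ) else 0) Set.univ ≤ 1 := by
      refine (eVariationOn_le_of_monotone_of_mem_Icc (c := 0) (d := 1) (fun s t hst => ?_)
        fun t => ?_).trans (by simp)
      · have := fun h : jumpTime n ≤ s => h.trans hst
        split_ifs <;> simp_all
      · split_ifs <;> simp
    calc _ ≤ ∫⁻ _, 1 ∂P := lintegral_mono fun _ => hle
      _ = 1 := by simp
  choose w N hw hwn hw₁ hX using fun n => exists_eq_jumpPath_of_mem_convexHull (hXt n)
  obtain rfl : Xt = fun n t _ => jumpPath jumpTime (w n) (N n) t := funext hX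
  -- The processes are told apart at time 1; an almost sure identity holds at some ω since P is
  -- nonzero.
  have hne : ∀ {Z W : ℝ≥0 → Ω → ℝ}, (∀ ω, Z 1 ω ≠ W 1 ω) → ¬ Indistinguishable P Z W :=
    fun h h' => let ⟨ω, hω⟩ := Eventually.exists h'; h ω (hω 1)
  refine ⟨isFatouLimit_of_eventually_eq continuousWithinAt_unitJump fun t => ?_,
    ⟨fun _ => 0, fun n => isItoIntegral_leftProc_unitJump (hw n) (hw₁ n), isFatouLimit_zero⟩,
    ⟨fun _ => 0, fun n => isStieltjesIntegral_leftProc_unitJump (hw n) (hw₁ n),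
      isFatouLimit_zero⟩,
    ⟨fun _ => 0, 0, fun n => isQuadCovariation_jumpPath_unitJump (hw n) (hw₁ n),
      isFatouLimit_zero, hne fun ω => by simp [unitJump_apply]⟩,
    ⟨fun _ t _ => unitJump t, fun t _ => unitJump t,
      fun n => isItoIntegral_leftProc_jumpPath (hw₁ n),
      isFatouLimit_of_eventually_eq continuousWithinAt_unitJump fun _ =>
        Eventually.of_forall fun _ _ => rfl, hne fun ω => by simp [unitJump_apply]⟩⟩
  rcases le_or_gt 1 t with ht | ht
  · exact Eventually.of_forall fun n ω => by
      simp [unitJump_apply, ht, jumpPath_jumpTime_of_one_le (hw₁ n)]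
  · filter_upwards [eventually_lt_jumpTime ht] with n hn ω
    simp [unitJump_apply, ht, jumpPath_jumpTime_of_lt (hwn n) hn]
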